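/- Let $B\subset\mathbb{R}^3$ be the open unit ball. Write $\mathcal{D}(B)$ for the smooth compactly supported functions on $B$ and $\mathcal{D}^1(B)$ for the smooth compactly supported $1$-forms on $B$. A $1$-current on $B$ is a continuous linear functional $T$ on $\mathcal{D}^1(B)$. Its boundary is the distribution $\langle\partial T,\varphi\rangle=\langle T,d\varphi\rangle$, $\varphi\in\mathcal{D}(B)$, and $T$ is a $1$-cycle if $\partial T=0$. Its mass is $\mathbb{M}(T)=\sup\{\langle T,\omega\rangle:\omega\in\mathcal{D}^1(B),\ |\omega(x)|\le 1\text{ for all }x\}\in[0,\infty]$. Let $\mathcal{R}_1(B)$ be the class of integer multiplicity rectifiable $1$-currents on $B$, i.e. those of the form $\langle T,\omega\rangle=\int_M\theta(x)\,\langle\omega(x),\tau(x)\rangle\,d\mathcal{H}^1(x)$, where $M\subset B$ is $\mathcal{H}^1$-measurable and countably $1$-rectifiable, $\theta\ge 1$ is integer valued and locally $\mathcal{H}^1$-integrable on $M$ in $B$, and $\tau$ is an $\mathcal{H}^1$-measurable unit vector field that spans the approximate tangent line of $M$ at $\mathcal{H}^1$-a.e. point of $M$. Let $X\in L^1_R(B)$: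 that is, $X\in L^1(B;\mathbb{R}^3)$, and there are finitely many points $x_1,\dots,x_m\in B$ and integers $h_1,\dots,h_m$ such that $X$ is smooth on $B\smallsetminus\{x_1,\dots,x_m\}$ and $\operatorname{div}X=\sum_{j=1}^m h_j\delta_{x_j}$ in the sense of distributions on $B$. Let $T_X$ be the $1$-current $\langle T_X,\omega\rangle=\int_B\langle\omega,X\rangle\,dx$. **Theorem.** There exist $L\in\mathcal{R}_1(B)$ with finite mass and a $1$-cycle $C$ on $B$ such that: 1. $T_X=C+L$; 2. $L$ is a mass-minimizer in the class $\{T\in\mathcal{R}_1(B):\partial T=\partial T_X\}$, and $$\mathbb{M}(L)=\sup_{\varphi\in\mathcal{D}(B),\ \|\nabla\varphi\|_{L^\infty(B)}\le 1}\langle\partial T_X,\varphi\rangle;$$ 3. $L$ is calibrated by an exact, essentially bounded $1$-form $d\varphi$, where $\varphi:B\to\mathbb{R}$ is $1$-Lipschitz and tends to $0$ at $\partial B$. That is, $|d\varphi|\le 1$ a.e. in $B$ and $\langle L,d\varphi\rangle=\mathbb{M}(L)$. Here, for $L$ given by $(M,\theta,\tau)$ as above, the pairing is taken along the tangent of $L$: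 $\langle L,d\varphi\rangle=\int_M\theta\,\partial_\tau\varphi\,d\mathcal{H}^1$, where the directional derivative $\partial_\tau\varphi$ exists $\mathcal{H}^1$-a.e. on $M$. -/

import Mathlib

open MeasureTheory Set Filter Topology TopologicalSpace
open scoped Distributions ENNReal

noncomputable section

namespace BallCurrents

/-- Euclidean three-space. -/
abbrev E3 : Type := EuclideanSpace ℝ (Fin 3)

/-- The open unit ball of `ℝ³`. -/
def unitBall : Opens E3 := ⟨Metric.ball 0 1, Metric.isOpen_ball⟩

/-- Smooth compactly supported `1`-forms on the open set `Ω`, with the LF topology. -/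
abbrev TestForm (Ω : Opens E3) : Type := 𝓓(Ω, E3 →L[ℝ] ℝ)

/-- `1`-currents on `Ω`: continuous linear functionals on the test `1`-forms. -/
abbrev Current (Ω : Opens E3) : Type := TestForm Ω →L[ℝ] ℝ

variable {Ω : Opens E3}

/-- The boundary of a `1`-current, a distribution: `⟨∂T, φ⟩ = ⟨T, dφ⟩`. -/
def boundary (T : Current Ω) : 𝓓(Ω, ℝ) →L[ℝ] ℝ :=
  T.comp (TestFunction.fderivCLM ℝ ⊤ ⊤)

/-- The differential used in `boundary` is the usual one. -/
theorem fderivCLM_coe (φ : 𝓓(Ω, ℝ)) (x : E3) :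
    (TestFunction.fderivCLM ℝ ⊤ ⊤ φ : TestForm Ω) x = fderiv ℝ φ x := by
  rw [TestFunction.fderivCLM_apply_of_le φ le_top]

/-- The `1`-current `⟨T_X, ω⟩ = ∫_Ω ω(X) dx` of a vector field that is integrable on `Ω`. -/
def currentOfField (Ω : Opens E3) (X : E3 → E3) : Current Ω :=
  TestFunction.integralAgainstBilinCLM (ContinuousLinearMap.id ℝ (E3 →L[ℝ] ℝ))
    (volume.restrict (Ω : Set E3)) X

/-- The defining formula of `currentOfField` (no default value is involved). -/
theorem currentOfField_apply {X : E3 → E3} (hX : IntegrableOn X (Ω : Set E3) volume)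
    (ω : TestForm Ω) : currentOfField Ω X ω = ∫ x in (Ω : Set E3), ω x (X x) := by
  have h : LocallyIntegrableOn X (Ω : Set E3) (volume.restrict (Ω : Set E3)) :=
    (Integrable.locallyIntegrable hX).locallyIntegrableOn _
  exact TestFunction.integralAgainstBilinCLM_eq_integral h

/-- The mass `𝐌(T) = sup {⟨T, ω⟩ : ‖ω(x)‖ ≤ 1 for all x}` of a `1`-current. (The operator norm of
a covector is its Euclidean norm, and the sup is over a set containing `0`.) -/
def mass (T : Current Ω) : ℝ≥0∞ :=
  ⨆ (ω : TestForm Ω) (_ : ∀ x, ‖ω x‖ ≤ 1), ENNReal.ofReal (T ω)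

/-- `X ∈ L¹(Ω; ℝ³)` is smooth away from integer point singularities: up to a null set it is smooth
on `Ω` minus a finite set `S` of points of `Ω`, and `div X = ∑_{a ∈ S} h(a) δ_a` in the sense of
distributions on `Ω`, with integers `h(a)`. -/
def SmoothAwayFromIntegerSingularities (Ω : Opens E3) (X : E3 → E3) : Prop :=
  IntegrableOn X (Ω : Set E3) volume ∧
  ∃ (S : Finset E3) (h : E3 → ℤ), (S : Set E3) ⊆ Ω ∧
    (∃ Y : E3 → E3, Y =ᵐ[volume.restrict (Ω : Set E3)] X ∧
      ContDiffOn ℝ (⊤ : ℕ∞) Y ((Ω : Set E3) \ S)) ∧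
    ∀ φ : 𝓓(Ω, ℝ), -∫ x in (Ω : Set E3), fderiv ℝ φ x (X x) = ∑ a ∈ S, (h a : ℝ) * φ a

/-- `M` is countably `1`-rectifiable: `ℋ¹`-almost all of it is covered by countably many
Lipschitz curves. -/
def CountablyRectifiable (M : Set E3) : Prop :=
  ∃ γ : ℕ → ℝ → E3, (∀ i, ∃ K, LipschitzWith K (γ i)) ∧
    Measure.hausdorffMeasure 1 (M \ ⋃ i, range (γ i)) = 0

/-- The unit vector `v` spans an approximate tangent line of `M` at `x`: the set `M` has positive
upper `ℋ¹`-density at `x`, and the part of `M` outside every cone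
`{y : dist (y - x, ℝ v) ≤ s |y - x|}`, `0 < s < 1`, has `ℋ¹`-density zero at `x`. -/
def SpansApproxTangent (M : Set E3) (x v : E3) : Prop :=
  ‖v‖ = 1 ∧
  0 < limsup (fun r : ℝ => Measure.hausdorffMeasure 1 (M ∩ Metric.closedBall x r)
        / ENNReal.ofReal (2 * r)) (𝓝[>] 0) ∧
  ∀ s ∈ Ioo (0 : ℝ) 1,
    Tendsto (fun r : ℝ => Measure.hausdorffMeasure 1
        {y ∈ M ∩ Metric.closedBall x r |
          s * ‖y - x‖ < Metric.infDist (y - x) (Submodule.span ℝ {v} : Set E3)}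
        / ENNReal.ofReal (2 * r)) (𝓝[>] 0) (𝓝 0)

/-- `T` is the integer multiplicity rectifiable current carried by `M`, with multiplicity `θ` and
orientation `τ`, i.e. `⟨T, ω⟩ = ∫_M θ(x) ω_x(τ(x)) dℋ¹(x)`. -/
structure IsRectifiableCurrent (T : Current Ω) (M : Set E3) (θ : E3 → ℕ) (τ : E3 → E3) :
    Prop where
  subset : M ⊆ Ω
  measurable : NullMeasurableSet M (Measure.hausdorffMeasure 1)
  rectifiable : CountablyRectifiable M
  mult_pos : ∀ x ∈ M, 1 ≤ θ x
  mult_locInt : LocallyIntegrableOn (fun x => (θ x : ℝ)) (Ω : Set E3)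
    ((Measure.hausdorffMeasure 1).restrict M)
  orient_meas : AEStronglyMeasurable τ ((Measure.hausdorffMeasure 1).restrict M)
  orient : ∀ᵐ x ∂(Measure.hausdorffMeasure 1).restrict M, SpansApproxTangent M x (τ x)
  eq_integral : ∀ ω : TestForm Ω,
    T ω = ∫ x in M, (θ x : ℝ) * ω x (τ x) ∂(Measure.hausdorffMeasure 1)

/-- The class `𝓡₁(Ω)` of integer multiplicity rectifiable `1`-currents on `Ω`. -/
def IntegerRectifiable (T : Current Ω) : Prop :=
  ∃ (M : Set E3) (θ : E3 → ℕ) (τ : E3 → E3), IsRectifiableCurrent T M θ τ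

/-- `L` is calibrated by the exact form `dφ`, `φ` Lipschitz: `dφ` has comass at most `1` almost
everywhere in `Ω`, and `⟨L, dφ⟩ = 𝐌(L)`. Since `dφ` is only defined almost everywhere with respect
to Lebesgue measure, its pairing with the rectifiable current `L` is taken along the tangent
of `L`: a Lipschitz function has, at `ℋ¹`-almost every point of a rectifiable set, a derivative in
the direction of the approximate tangent, and
`⟨L, dφ⟩ = ∫_M θ(x) ∂φ/∂τ(x) dℋ¹(x)`. -/
def IsCalibratedBy (L : Current Ω) (φ : E3 → ℝ) : Prop :=
  (∀ᵐ x ∂volume.restrict (Ω : Set E3), DifferentiableAt ℝ φ x ∧ ‖fderiv ℝ φ x‖ ≤ 1) ∧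
  ∃ (M : Set E3) (θ : E3 → ℕ) (τ : E3 → E3), IsRectifiableCurrent L M θ τ ∧
    (∀ᵐ x ∂(Measure.hausdorffMeasure 1).restrict M, LineDifferentiableAt ℝ φ x (τ x)) ∧
    IntegrableOn (fun x => (θ x : ℝ) * lineDeriv ℝ φ x (τ x)) M (Measure.hausdorffMeasure 1) ∧
    mass L = ENNReal.ofReal
      (∫ x in M, (θ x : ℝ) * lineDeriv ℝ φ x (τ x) ∂(Measure.hausdorffMeasure 1))

end BallCurrents

end

open BallCurrents

namespace BallCurrents

/-! The boundary of `T_X` is a finite integer combination of point masses, so `L` can be sought as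
an optimal system of straight segments joining charges of opposite sign, or joining a charge to the
sphere, where mass may enter or leave for free. This is a finite assignment problem for the cost
`connCost`. A minimizing permutation has dual potentials `a` (`exists_optimal_assignment`, from
Birkhoff's theorem and a shortest-path argument), and the envelope `min_i (a i + connCost (x i) z)`,
normalised by a constant, is a 1-Lipschitz function `φ` vanishing outside the ball and tight on
every assigned pair. Thus `φ` grows with unit speed along every segment
(`exists_calibrated_connection`).

This one function gives all the conclusions. Segments meeting at an interior point must have the
same direction (`direction_eq_of_mem_arc`), so overlaps only add multiplicity and the sum `L` is
integer rectifiable. Smoothing `φ` to test functions of gradient at most one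
(`exists_testFunction_approx`) yields mass of `L` ≤ total length ≤ supremum over test functions ≤
mass of any current with the same boundary. Taking `L` itself at the end forces equality throughout.
The cycle is `C = T_X - L`. -/

/-! ### Duality for the finite assignment problem -/

/-- A circulation has nonnegative cost as soon as every permutation has nonnegative cost. -/
theorem circulation_cost_nonneg {ι : Type*} [Fintype ι] [DecidableEq ι] {c : ι → ι → ℝ}
    (hc0 : ∀ i, c i i = 0) (hc : ∀ σ : Equiv.Perm ι, 0 ≤ ∑ i, c i (σ i))
    {N : ι → ι → ℝ} (hN : ∀ i j, 0 ≤ N i j) (hcirc : ∀ i, ∑ j, N i j = ∑ j, N j i) :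
    0 ≤ ∑ i, ∑ j, N i j * c i j := by
  set m : ℝ := 1 + ∑ i, ∑ j, N i j with hm
  have hrow : ∀ i, ∑ j, N i j ≤ m := fun i => by
    have := Finset.single_le_sum (f := fun i => ∑ j, N i j)
      (fun i _ => Finset.sum_nonneg fun j _ => hN i j) (Finset.mem_univ i)
    linarith
  have hm0 : 0 < m := by
    have : 0 ≤ ∑ i, ∑ j, N i j := Finset.sum_nonneg fun i _ => Finset.sum_nonneg fun j _ => hN i j
    linarith
  -- Loading the diagonal brings every row and column sum to the same `m`; as `c i i = 0` this
  -- leaves the cost unchanged. Birkhoff's theorem then writes the rescaled matrix as a convex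
  -- combination of permutations.
  let M : Matrix ι ι ℝ :=
    fun i j => m⁻¹ * (N i j + if i = j then m - ∑ l, N i l else 0)
  have hM : M ∈ doublyStochastic ℝ ι := by
    rw [mem_doublyStochastic_iff_sum]
    refine ⟨fun i j => ?_, fun i => ?_, fun j => ?_⟩
    · refine mul_nonneg (by positivity) (add_nonneg (hN i j) ?_)
      split_ifs
      · linarith [hrow i]
      · exact le_rfl
    · simp only [M, ← Finset.mul_sum, Finset.sum_add_distrib, Finset.sum_ite_eq,
        Finset.mem_univ, if_true]
      field_simp
      ring
    · simp only [M, ← Finset.mul_sum, Finset.sum_add_distrib, Finset.sum_ite_eq',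
        Finset.mem_univ, if_true]
      rw [hcirc j]
      field_simp
      ring
  obtain ⟨w, hw0, -, hwM⟩ := exists_eq_sum_perm_of_mem_doublyStochastic hM
  have hcost : ∑ i, ∑ j, M i j * c i j = ∑ σ : Equiv.Perm ι, w σ * ∑ i, c i (σ i) := by
    have h1 : ∀ i j, M i j = ∑ σ : Equiv.Perm ι, w σ * if σ i = j then 1 else 0 := by
      intro i j
      rw [← hwM, Matrix.sum_apply]
      refine Finset.sum_congr rfl fun σ _ => ?_
      simp [Equiv.Perm.permMatrix, PEquiv.toMatrix_apply, Equiv.toPEquiv_apply, eq_comm]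
    simp only [h1, Finset.sum_mul, Finset.mul_sum]
    rw [Finset.sum_congr rfl fun i _ => Finset.sum_comm, Finset.sum_comm]
    refine Finset.sum_congr rfl fun σ _ => Finset.sum_congr rfl fun i _ => ?_
    simp
  have hcost' : ∑ i, ∑ j, M i j * c i j = m⁻¹ * ∑ i, ∑ j, N i j * c i j := by
    simp only [Finset.mul_sum]
    refine Finset.sum_congr rfl fun i _ => Finset.sum_congr rfl fun j _ => ?_
    by_cases h : i = j
    · subst h; simp [hc0]
    · simp [M, h, mul_assoc]
  have h0 : 0 ≤ m⁻¹ * ∑ i, ∑ j, N i j * c i j := by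
    rw [← hcost', hcost]
    exact Finset.sum_nonneg fun σ _ => mul_nonneg (hw0 σ) (hc σ)
  exact nonneg_of_mul_nonneg_right h0 (inv_pos.2 hm0)

/-- Difference constraints are solvable if every permutation has nonnegative cost. -/
theorem exists_potential {ι : Type*} [Fintype ι] [DecidableEq ι] {c : ι → ι → ℝ}
    (hc0 : ∀ i, c i i = 0) (hc : ∀ σ : Equiv.Perm ι, 0 ≤ ∑ i, c i (σ i)) :
    ∃ a : ι → ℝ, ∀ i j, a i ≤ a j + c j i := by
  rcases isEmpty_or_nonempty ι with hι | ⟨⟨r⟩⟩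
  · exact ⟨0, fun i => isEmptyElim i⟩
  let δ : ι → ι → ι → ι → ℝ := fun s t i j => (if i = s then 1 else 0) * if j = t then 1 else 0
  have hδ0 : ∀ s t i j, 0 ≤ δ s t i j := fun s t i j => by
    simp only [δ]; split_ifs <;> simp
  have hδrow : ∀ s t i, ∑ j, δ s t i j = if i = s then 1 else 0 := fun s t i => by simp [δ]
  have hδcol : ∀ s t i, ∑ j, δ s t j i = if i = t then 1 else 0 := fun s t i => by simp [δ]
  have hδcost : ∀ s t, ∑ i, ∑ j, δ s t i j * c i j = c s t := fun s t => by
    simp [δ]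
  -- Unit flows from the root `r` to `t`. Their infimal cost plays the role of the shortest-path
  -- distance from `r`, and will be the potential.
  let flows : ι → Set (ι → ι → ℝ) := fun t => {N | (∀ i j, 0 ≤ N i j) ∧
    ∀ i, ∑ j, N i j + (if i = t then 1 else 0) = ∑ j, N j i + if i = r then 1 else 0}
  let cost : (ι → ι → ℝ) → ℝ := fun N => ∑ i, ∑ j, N i j * c i j
  have hcost_add : ∀ N s t, cost (fun i j => N i j + δ s t i j) = cost N + c s t := by
    intro N s t
    simp only [cost, add_mul, Finset.sum_add_distrib, hδcost]
  have hne : ∀ t, (flows t).Nonempty := fun t =>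
    ⟨δ r t, hδ0 r t, fun i => by rw [hδrow, hδcol, add_comm]⟩
  have hbdd : ∀ t, BddBelow (cost '' flows t) := by
    intro t
    -- Adding the edge from `t` back to `r` closes the flow into a circulation, whose cost is
    -- nonnegative.
    refine ⟨-c t r, ?_⟩
    rintro _ ⟨N, ⟨hN0, hN⟩, rfl⟩
    have := circulation_cost_nonneg hc0 hc (N := fun i j => N i j + δ t r i j)
      (fun i j => add_nonneg (hN0 i j) (hδ0 t r i j)) (fun i => by
        rw [Finset.sum_add_distrib, Finset.sum_add_distrib, hδrow, hδcol, hN])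
    have h2 := hcost_add N t r
    simp only [cost] at h2 ⊢
    linarith
  refine ⟨fun t => sInf (cost '' flows t), fun i j => ?_⟩
  rw [← sub_le_iff_le_add]
  -- A flow to `j` followed by the edge from `j` to `i` is a flow to `i`.
  refine le_csInf ((hne j).image _) ?_
  rintro _ ⟨N, ⟨hN0, hN⟩, rfl⟩
  rw [sub_le_iff_le_add, ← hcost_add]
  refine csInf_le (hbdd i) ⟨_, ⟨fun k l => add_nonneg (hN0 k l) (hδ0 j i k l), fun k => ?_⟩, rfl⟩
  rw [Finset.sum_add_distrib, Finset.sum_add_distrib, hδrow, hδcol]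
  linarith [hN k]

/-- An optimal assignment admits dual potentials. -/
theorem exists_optimal_assignment {ι α : Type*} [Fintype ι] (d : α → α → ℝ) (x y : ι → α) :
    ∃ (σ : Equiv.Perm ι) (a : ι → ℝ),
      ∀ i j, a i + d (x i) (y (σ i)) ≤ a j + d (x j) (y (σ i)) := by
  classical
  obtain ⟨σ, hσ⟩ := Finite.exists_min fun σ : Equiv.Perm ι => ∑ i, d (x i) (y (σ i))
  -- The cost of a permutation `τ` is here the change in total cost when `σ` is replaced by `σ * τ`,
  -- nonnegative by minimality.
  obtain ⟨a, ha⟩ := exists_potential (c := fun j i => d (x j) (y (σ i)) - d (x i) (y (σ i)))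
    (fun i => sub_self _) (fun τ => by
      have h := hσ (σ * τ)
      have h2 := Equiv.sum_comp τ fun i => d (x i) (y (σ i))
      rw [Finset.sum_sub_distrib, h2]
      simpa using h)
  exact ⟨σ, a, fun i j => by linarith [ha i j]⟩

/-! ### Optimal connections with the sphere as a free reservoir -/

/-- The distance to the complement of the unit ball. -/
noncomputable def depth (x : E3) : ℝ := max (1 - ‖x‖) 0

theorem depth_nonneg (x : E3) : 0 ≤ depth x := le_max_right _ _

theorem depth_eq_zero {x : E3} (hx : 1 ≤ ‖x‖) : depth x = 0 := max_eq_right (by linarith)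

theorem depth_le (x y : E3) : depth x ≤ depth y + ‖y - x‖ := by
  have h1 : 1 - ‖y‖ ≤ depth y := le_max_left _ _
  have h2 := norm_sub_norm_le y x
  exact max_le (by linarith) (add_nonneg (depth_nonneg y) (norm_nonneg _))

/-- Every point of the closed ball has a nearest point on the sphere. -/
theorem exists_sphere_dist_eq_depth {z : E3} (hz : ‖z‖ ≤ 1) :
    ∃ w : E3, ‖w‖ = 1 ∧ ‖w - z‖ = depth z := by
  rcases eq_or_ne z 0 with rfl | h0
  · exact ⟨EuclideanSpace.single 0 1, by simp, by simp [depth]⟩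
  · have h2 : 0 < ‖z‖ := norm_pos_iff.2 h0
    refine ⟨‖z‖⁻¹ • z, by rw [norm_smul, norm_inv, norm_norm, inv_mul_cancel₀ h2.ne'], ?_⟩
    have : ‖z‖⁻¹ • z - z = (‖z‖⁻¹ - 1) • z := by rw [sub_smul, one_smul]
    have h3 : 0 ≤ ‖z‖⁻¹ - 1 := by
      rw [sub_nonneg]; exact (one_le_inv₀ h2).2 hz
    rw [this, norm_smul, Real.norm_of_nonneg h3, depth, max_eq_left (by linarith)]
    field_simp

/-- The length of the shortest connection from `x` to `y`, travel outside the ball being free. -/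
noncomputable def connCost (x y : E3) : ℝ := min ‖y - x‖ (depth x + depth y)

/-- Both competitors, the straight path and the detour through the sphere, are 1-Lipschitz in the
endpoint. The potential built as a minimum of such costs inherits this. -/
theorem connCost_le (x y z : E3) : connCost x z ≤ connCost x y + ‖z - y‖ := by
  unfold connCost
  rw [min_add]
  refine le_min ((min_le_left _ _).trans ?_) ((min_le_right _ _).trans ?_)
  · linarith [norm_sub_le_norm_sub_add_norm_sub z y x]
  · linarith [depth_le z y, norm_sub_rev y z]

theorem connCost_of_one_le {x z : E3} (hz : 1 ≤ ‖z‖) : connCost x z = depth x := by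
  unfold connCost
  rw [depth_eq_zero hz, add_zero, min_eq_right]
  simpa [depth_eq_zero hz] using depth_le x z

/-- Kantorovich duality for the assignment problem in the ball: an optimal assignment together with
a `1`-Lipschitz function that vanishes outside the ball and is tight along the assignment. -/
theorem exists_tight_lipschitz {ι : Type*} [Fintype ι] [Nonempty ι] (x y : ι → E3) :
    ∃ (σ : Equiv.Perm ι) (φ : E3 → ℝ), LipschitzWith 1 φ ∧ (∀ z, 1 ≤ ‖z‖ → φ z = 0) ∧
      ∀ i, φ (y (σ i)) - φ (x i) = connCost (x i) (y (σ i)) := by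
  obtain ⟨σ, a, ha⟩ := exists_optimal_assignment connCost x y
  let ψ : E3 → ℝ := fun z => Finset.univ.inf' Finset.univ_nonempty fun i => a i + connCost (x i) z
  have hψle : ∀ z i, ψ z ≤ a i + connCost (x i) z := fun z i =>
    Finset.inf'_le _ (Finset.mem_univ i)
  have hψ : ∀ z w, ψ z ≤ ψ w + ‖z - w‖ := fun z w => by
    obtain ⟨i, -, hi⟩ := Finset.exists_mem_eq_inf' Finset.univ_nonempty
      fun i => a i + connCost (x i) w
    have h1 : ψ w = a i + connCost (x i) w := hi
    linarith [hψle z i, connCost_le (x i) w z]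
  let e : E3 := EuclideanSpace.single 0 1
  have he : ‖e‖ = 1 := by simp [e]
  have hψout : ∀ z, 1 ≤ ‖z‖ → ψ z = ψ e := fun z hz => by
    simp only [ψ, connCost_of_one_le hz, connCost_of_one_le he.ge]
  have hlip : ∀ z w, (ψ z - ψ e) - (ψ w - ψ e) ≤ ‖z - w‖ := fun z w => by linarith [hψ z w]
  refine ⟨σ, fun z => ψ z - ψ e, LipschitzWith.of_le_add fun z w => ?_,
    fun z hz => sub_eq_zero.2 (hψout z hz), fun i => ?_⟩
  · rw [dist_eq_norm]; linarith [hlip z w]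
  -- Pass through nearest points of the sphere, between which `ψ` does not change.
  · have hout : ∀ z w, ψ z - ψ w ≤ depth z + depth w := by
      have key : ∀ z, ∃ w, 1 ≤ ‖w‖ ∧ ‖w - z‖ = depth z := fun z => by
        rcases le_total 1 ‖z‖ with hz | hz
        · exact ⟨z, hz, by simp [depth_eq_zero hz]⟩
        · obtain ⟨w, hw, h⟩ := exists_sphere_dist_eq_depth hz
          exact ⟨w, hw.ge, h⟩
      intro z w
      obtain ⟨z', hz', hz⟩ := key z
      obtain ⟨w', hw', hw⟩ := key w
      have h1 := hψ z z'
      have h2 := hψ w' w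
      rw [hψout _ hz', norm_sub_rev] at h1
      rw [hψout _ hw'] at h2
      linarith
    -- Dual feasibility says that the index `i` attains the minimum defining `ψ` at `y (σ i)`.
    have hy : ψ (y (σ i)) = a i + connCost (x i) (y (σ i)) :=
      le_antisymm (hψle _ i) (Finset.le_inf' _ _ fun j _ => ha i j)
    have hx : ψ (x i) ≤ a i := by
      have := hψle (x i) i
      have h0 : connCost (x i) (x i) ≤ 0 := (min_le_left _ _).trans (by simp)
      linarith
    have h1 : ψ (y (σ i)) - ψ (x i) ≤ connCost (x i) (y (σ i)) :=
      le_min (by linarith [hψ (y (σ i)) (x i)])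
        (by linarith [hout (y (σ i)) (x i)])
    show (ψ (y (σ i)) - ψ e) - (ψ (x i) - ψ e) = _
    linarith

/-- A pair that is tight for `connCost` is realised by two tight straight segments. -/
theorem exists_tight_segments {φ : E3 → ℝ} (hφ : LipschitzWith 1 φ)
    (hout : ∀ z, 1 ≤ ‖z‖ → φ z = 0) {x y : E3} (hx : ‖x‖ ≤ 1) (hy : ‖y‖ ≤ 1)
    (hxy : φ y - φ x = connCost x y) :
    ∃ p q : Bool → E3, (∀ b, ‖p b‖ ≤ 1 ∧ ‖q b‖ ≤ 1 ∧ φ (q b) - φ (p b) = ‖q b - p b‖) ∧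
      ∀ f : E3 → ℝ, (∀ z, 1 ≤ ‖z‖ → f z = 0) → ∑ b, (f (q b) - f (p b)) = f y - f x := by
  rcases le_total ‖y - x‖ (depth x + depth y) with h | h
  -- The straight path needs only one segment; the other is the degenerate one from `y` to `y`,
  -- discarded later.
  · refine ⟨fun b => cond b x y, fun _ => y, ?_, fun f _ => by rw [Fintype.sum_bool]; simp⟩
    rw [connCost, min_eq_left h] at hxy
    rintro (_ | _)
    · simp [hy]
    · simp [hx, hy, hxy]
  · obtain ⟨x', hx', hxd⟩ := exists_sphere_dist_eq_depth hx
    obtain ⟨y', hy', hyd⟩ := exists_sphere_dist_eq_depth hy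
    rw [connCost, min_eq_right h] at hxy
    have hl : ∀ z w, φ z - φ w ≤ ‖z - w‖ := fun z w => by
      have := hφ.dist_le_mul z w
      rw [Real.dist_eq, dist_eq_norm, NNReal.coe_one, one_mul] at this
      exact (le_abs_self _).trans this
    have h1 := hl x' x
    have h2 := hl y y'
    rw [norm_sub_rev] at h2
    rw [hout _ hx'.ge] at h1
    rw [hout _ hy'.ge] at h2
    refine ⟨fun b => cond b x y', fun b => cond b x' y, ?_, fun f hf => ?_⟩
    · rintro (_ | _)
      · refine ⟨hy'.le, hy, ?_⟩
        simp only [cond_false, hout _ hy'.ge]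
        rw [norm_sub_rev]
        linarith
      · refine ⟨hx, hx'.le, ?_⟩
        simp only [cond_true, hout _ hx'.ge]
        linarith
    · rw [Fintype.sum_bool]
      simp only [cond_true, cond_false, hf _ hx'.ge, hf _ hy'.ge]
      ring

/-- Every finite integer charge in the ball is the boundary, relative to the complement of the ball,
of finitely many segments along each of which one common `1`-Lipschitz function grows with unit
speed. -/
theorem exists_calibrated_connection (S : Finset E3) (hS : ∀ a ∈ S, ‖a‖ ≤ 1) (k : E3 → ℤ) :
    ∃ (J : Type) (_ : Fintype J) (p q : J → E3) (φ : E3 → ℝ),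
      LipschitzWith 1 φ ∧ (∀ z, 1 ≤ ‖z‖ → φ z = 0) ∧
      (∀ i, p i ≠ q i ∧ ‖p i‖ ≤ 1 ∧ ‖q i‖ ≤ 1 ∧ φ (q i) - φ (p i) = ‖q i - p i‖) ∧
      ∀ f : E3 → ℝ, (∀ z, 1 ≤ ‖z‖ → f z = 0) →
        ∑ i, (f (q i) - f (p i)) = ∑ a ∈ S, (k a : ℝ) * f a := by
  classical
  -- One index per unit of charge, each matched with the sphere point `e`, which may stand for any
  -- point outside since its depth is zero. The extra index pairs `e` with itself and keeps the
  -- index type nonempty.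
  let I : Type := Option (Σ a : S, Fin (k a).natAbs)
  let e : E3 := EuclideanSpace.single 0 1
  have he : ‖e‖ = 1 := by simp [e]
  let x : I → E3 := fun i => i.elim e fun s => if 0 ≤ k s.1 then e else s.1
  let y : I → E3 := fun i => i.elim e fun s => if 0 ≤ k s.1 then s.1 else e
  have hx : ∀ i, ‖x i‖ ≤ 1 := by
    rintro (_ | s)
    · exact he.le
    · simp only [x, Option.elim]; split_ifs
      · exact he.le
      · exact hS _ s.1.2
  have hy : ∀ i, ‖y i‖ ≤ 1 := by
    rintro (_ | s)
    · exact he.le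
    · simp only [y, Option.elim]; split_ifs
      · exact hS _ s.1.2
      · exact he.le
  obtain ⟨σ, φ, hφ, hout, htight⟩ := exists_tight_lipschitz x y
  choose p q hpq hsum using fun i =>
    exists_tight_segments hφ hout (hx i) (hy (σ i)) (htight i)
  refine ⟨{j : I × Bool // p j.1 j.2 ≠ q j.1 j.2}, inferInstance, fun j => p j.1.1 j.1.2,
    fun j => q j.1.1 j.1.2, φ, hφ, hout, fun j => ⟨j.2, hpq j.1.1 j.1.2⟩, fun f hf => ?_⟩
  have h1 : ∑ j : {j : I × Bool // p j.1 j.2 ≠ q j.1 j.2},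
      (f (q j.1.1 j.1.2) - f (p j.1.1 j.1.2)) =
      ∑ j : I × Bool, (f (q j.1 j.2) - f (p j.1 j.2)) := by
    rw [← Finset.sum_subtype (Finset.univ.filter fun j : I × Bool => p j.1 j.2 ≠ q j.1 j.2)
      (by simp) fun j => f (q j.1 j.2) - f (p j.1 j.2)]
    refine Finset.sum_filter_of_ne fun j _ hj heq => hj ?_
    rw [heq, sub_self]
  rw [h1, Fintype.sum_prod_type]
  simp only [fun i => hsum i f hf]
  rw [Finset.sum_sub_distrib, Equiv.sum_comp σ fun i => f (y i), ← Finset.sum_sub_distrib,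
    Fintype.sum_option, Fintype.sum_sigma, ← Finset.sum_coe_sort S]
  simp only [x, y, Option.elim, sub_self, zero_add]
  refine Finset.sum_congr rfl fun a _ => ?_
  rw [Finset.sum_const, Finset.card_univ, Fintype.card_fin, nsmul_eq_mul, Nat.cast_natAbs,
    Int.cast_abs]
  split_ifs with h
  · rw [hf e he.ge, sub_zero, abs_of_nonneg (by exact_mod_cast h)]
  · rw [hf e he.ge, abs_of_neg (by exact_mod_cast not_le.1 h)]; ring

/-! ### Smooth approximation of the calibrating potential -/

open ContinuousLinearMap in
/-- Mollification preserves the Lipschitz constant. -/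
theorem lipschitzWith_normed_convolution (η : ContDiffBump (0 : E3)) {g : E3 → ℝ}
    (hg : LipschitzWith 1 g) :
    LipschitzWith 1 (convolution (η.normed volume) g (lsmul ℝ ℝ) volume) := by
  have hex : ∀ x, ConvolutionExistsAt (η.normed volume) g x (lsmul ℝ ℝ) volume :=
    η.hasCompactSupport_normed.convolutionExists_left _ η.continuous_normed
      hg.continuous.locallyIntegrable
  refine LipschitzWith.of_dist_le_mul fun x y => ?_
  rw [NNReal.coe_one, one_mul, Real.dist_eq, convolution_def, convolution_def,
    ← integral_sub (hex x) (hex y), ← Real.norm_eq_abs]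
  have h1 : ∫ t, η.normed volume t * dist x y = dist x y := by
    rw [integral_mul_const, η.integral_normed, one_mul]
  rw [← h1]
  refine norm_integral_le_of_norm_le (η.integrable_normed.mul_const _) (Eventually.of_forall ?_)
  intro t
  have h2 := hg.dist_le_mul (x - t) (y - t)
  rw [NNReal.coe_one, one_mul, dist_sub_right, Real.dist_eq] at h2
  simp only [lsmul_apply, smul_eq_mul]
  rw [← mul_sub, Real.norm_eq_abs, abs_mul, abs_of_nonneg (η.nonneg_normed t)]
  exact mul_le_mul_of_nonneg_left h2 (η.nonneg_normed t)

/-- Soft thresholding. -/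
noncomputable def softThreshold (δ t : ℝ) : ℝ := max (t - δ) 0 + min (t + δ) 0

theorem softThreshold_of_abs_le {δ t : ℝ} (h : |t| ≤ δ) : softThreshold δ t = 0 := by
  rw [abs_le] at h
  rw [softThreshold, max_eq_right (by linarith), min_eq_right (by linarith), add_zero]

theorem abs_softThreshold_sub_le {δ : ℝ} (hδ : 0 ≤ δ) (t : ℝ) : |softThreshold δ t - t| ≤ δ := by
  rw [abs_le, softThreshold]
  rcases max_cases (t - δ) 0 with h | h <;> rcases min_cases (t + δ) 0 with h' | h' <;>
    constructor <;> linarith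

/-- This is the advantage over multiplication by a cutoff: the support becomes compact with no loss
in the gradient bound. -/
theorem lipschitzWith_softThreshold {δ : ℝ} (hδ : 0 ≤ δ) : LipschitzWith 1 (softThreshold δ) := by
  refine LipschitzWith.of_le_add fun s t => ?_
  rw [Real.dist_eq, softThreshold, softThreshold]
  have h0 := le_abs_self (s - t)
  have h0' := abs_nonneg (s - t)
  rcases max_cases (s - δ) 0 with h | h <;> rcases min_cases (s + δ) 0 with h' | h' <;>
    rcases max_cases (t - δ) 0 with h'' | h'' <;> rcases min_cases (t + δ) 0 with h3 | h3 <;>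
    linarith

/-- A `1`-Lipschitz function vanishing outside the ball is a uniform limit of test functions with
gradient bounded by one. -/
theorem exists_testFunction_approx {φ : E3 → ℝ} (hφ : LipschitzWith 1 φ)
    (hout : ∀ z, 1 ≤ ‖z‖ → φ z = 0) {ε : ℝ} (hε : 0 < ε) :
    ∃ ψ : 𝓓(unitBall, ℝ), (∀ x, ‖fderiv ℝ ψ x‖ ≤ 1) ∧ ∀ x, |ψ x - φ x| ≤ ε := by
  set δ := ε / 2 with hδ
  have hδ0 : 0 < δ := by positivity
  let g : E3 → ℝ := fun x => softThreshold δ (φ x)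
  have hg : LipschitzWith 1 g := by
    have h := (lipschitzWith_softThreshold hδ0.le).comp hφ
    rwa [one_mul] at h
  -- Since `|φ|` is at most the distance to the sphere inside the ball, thresholding at `δ` clears a
  -- collar of width `δ`. Mollifying at radius `δ / 2` uses up half of it, and the total error is at
  -- most `δ + δ / 2 ≤ ε`.
  have hsmall : ∀ z, 1 - δ ≤ ‖z‖ → g z = 0 := by
    intro z hz
    refine softThreshold_of_abs_le ?_
    rcases le_total 1 ‖z‖ with h | h
    · rw [hout z h, abs_zero]; exact hδ0.le
    · obtain ⟨w, hw, hwz⟩ := exists_sphere_dist_eq_depth h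
      have h2 := hφ.dist_le_mul z w
      rw [hout w hw.ge, NNReal.coe_one, one_mul, dist_zero_right, dist_comm, dist_eq_norm, hwz,
        Real.norm_eq_abs] at h2
      exact h2.trans (max_le (by linarith) hδ0.le)
  let η : ContDiffBump (0 : E3) := ⟨δ / 4, δ / 2, by positivity, by linarith⟩
  let ψ : E3 → ℝ := convolution (η.normed volume) g (ContinuousLinearMap.lsmul ℝ ℝ) volume
  have hψlip : LipschitzWith 1 ψ := lipschitzWith_normed_convolution η hg
  have hψ0 : ∀ x, 1 - δ / 2 ≤ ‖x‖ → ψ x = 0 := by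
    intro x hx
    have hgx : g x = 0 := hsmall x (by linarith)
    rw [← hgx]
    refine η.normed_convolution_eq_right fun z hz => ?_
    rw [hgx]
    refine hsmall z ?_
    have h1 : dist z x < δ / 2 := hz
    rw [dist_comm, dist_eq_norm] at h1
    linarith [norm_sub_norm_le x z]
  have hsupp : tsupport ψ ⊆ Metric.closedBall 0 (1 - δ / 2) := by
    refine closure_minimal (fun x hx => ?_) Metric.isClosed_closedBall
    by_contra h
    rw [mem_closedBall_zero_iff, not_le] at h
    exact hx (hψ0 x h.le)
  refine ⟨⟨ψ, ?_, ?_, ?_⟩, fun x => ?_, fun x => ?_⟩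
  · exact η.hasCompactSupport_normed.contDiff_convolution_left _ η.contDiff_normed
      hg.continuous.locallyIntegrable
  · exact (isCompact_closedBall (0 : E3) (1 - δ / 2)).of_isClosed_subset (isClosed_tsupport _) hsupp
  · exact hsupp.trans (Metric.closedBall_subset_ball (by linarith))
  · have h := norm_fderiv_le_of_lipschitz ℝ hψlip (x₀ := x)
    rwa [NNReal.coe_one] at h
  · have h1 : dist (ψ x) (g x) ≤ δ / 2 := by
      refine η.dist_normed_convolution_le hg.continuous.aestronglyMeasurable fun z hz => ?_
      have := hg.dist_le_mul z x
      rw [NNReal.coe_one, one_mul] at this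
      exact this.trans (le_of_lt hz)
    have h2 : |g x - φ x| ≤ δ := abs_softThreshold_sub_le hδ0.le (φ x)
    rw [Real.dist_eq] at h1
    show |ψ x - φ x| ≤ ε
    linarith [abs_sub_le (ψ x) (g x) (φ x)]

-- Segments, arc length and unit slope

local notation "ℋ¹" => (Measure.hausdorffMeasure 1 : Measure E3)

/-- The arc-length parametrised line through `p` in the direction `u`. -/
def line (p u : E3) (t : ℝ) : E3 := p + t • u

theorem line_sub_line (p u : E3) (s t : ℝ) : line p u s - line p u t = (s - t) • u := by
  simp only [line, sub_smul]; abel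

theorem line_line (p u : E3) (s t : ℝ) : line (line p u s) u t = line p u (s + t) := by
  simp only [line, add_smul, add_assoc]

theorem isometry_line (p : E3) {u : E3} (hu : ‖u‖ = 1) : Isometry (line p u) :=
  Isometry.of_dist_eq fun s t => by
    rw [dist_eq_norm, line_sub_line, norm_smul, hu, mul_one, dist_eq_norm]

theorem measurableEmbedding_line (p : E3) {u : E3} (hu : ‖u‖ = 1) :
    MeasurableEmbedding (line p u) :=
  (isometry_line p hu).isClosedEmbedding.measurableEmbedding

/-- `ℋ¹` on a line is the image of Lebesgue measure. -/
theorem hausdorffMeasure_restrict_line_image (p : E3) {u : E3} (hu : ‖u‖ = 1) {A : Set ℝ}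
    (hA : MeasurableSet A) :
    ℋ¹.restrict (line p u '' A) = (volume.restrict A).map (line p u) := by
  have hγ := measurableEmbedding_line p hu
  have h1 := (isometry_line p hu).map_hausdorffMeasure (d := 1) (Or.inl zero_le_one)
  rw [hausdorffMeasure_real] at h1
  have h2 : line p u ⁻¹' (line p u '' A) = A := preimage_image_eq _ hγ.injective
  rw [← h2, ← hγ.restrict_map, h1, h2, Measure.restrict_restrict (hγ.measurableSet_image.2 hA),
    inter_eq_self_of_subset_left (image_subset_range _ _)]

theorem hausdorffMeasure_line_image (p : E3) {u : E3} (hu : ‖u‖ = 1) {A : Set ℝ}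
    (hA : MeasurableSet A) : ℋ¹ (line p u '' A) = volume A := by
  rw [← Measure.restrict_apply_self, hausdorffMeasure_restrict_line_image p hu hA,
    (measurableEmbedding_line p hu).map_apply,
    preimage_image_eq _ (measurableEmbedding_line p hu).injective, Measure.restrict_apply_self]

/-- The unit vector pointing from `p` to `q`. -/
noncomputable def direction (p q : E3) : E3 := ‖q - p‖⁻¹ • (q - p)

theorem norm_direction {p q : E3} (h : p ≠ q) : ‖direction p q‖ = 1 := by
  have : ‖q - p‖ ≠ 0 := norm_ne_zero_iff.2 (sub_ne_zero.2 h.symm)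
  rw [direction, norm_smul, norm_inv, norm_norm, inv_mul_cancel₀ this]

theorem line_zero (p u : E3) : line p u 0 = p := by simp [line]

theorem line_direction_norm {p q : E3} (h : p ≠ q) : line p (direction p q) ‖q - p‖ = q := by
  have : ‖q - p‖ ≠ 0 := norm_ne_zero_iff.2 (sub_ne_zero.2 h.symm)
  rw [line, direction, smul_smul, mul_inv_cancel₀ this, one_smul, add_sub_cancel]

/-- The open segment from `p` to `q`, parametrised by arc length. -/
def arc (p q : E3) : Set E3 := line p (direction p q) '' Ioo 0 ‖q - p‖

section arc

variable {p q : E3}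

theorem measurableSet_arc (h : p ≠ q) : MeasurableSet (arc p q) :=
  (measurableEmbedding_line p (norm_direction h)).measurableSet_image.2 measurableSet_Ioo

theorem hausdorffMeasure_arc (h : p ≠ q) : ℋ¹ (arc p q) = ENNReal.ofReal ‖q - p‖ := by
  rw [arc, hausdorffMeasure_line_image _ (norm_direction h) measurableSet_Ioo, Real.volume_Ioo,
    sub_zero]

/-- Strict convexity of the ball. Endpoints may lie on the sphere, which is why `arc` omits them. -/
theorem arc_subset_ball (h : p ≠ q) (hp : ‖p‖ ≤ 1) (hq : ‖q‖ ≤ 1) :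
    arc p q ⊆ Metric.ball 0 1 := by
  have h0 : 0 < ‖q - p‖ := norm_pos_iff.2 (sub_ne_zero.2 h.symm)
  rintro _ ⟨t, ht, rfl⟩
  have hs := (strictConvex_closedBall ℝ (0 : E3) 1).openSegment_subset
    (mem_closedBall_zero_iff.2 hp) (mem_closedBall_zero_iff.2 hq) h
  rw [interior_closedBall _ one_ne_zero] at hs
  refine hs ?_
  rw [openSegment_eq_image']
  refine ⟨t / ‖q - p‖, ⟨div_pos ht.1 h0, (div_lt_one h0).2 ht.2⟩, ?_⟩
  simp [line, direction, smul_smul, div_eq_mul_inv]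

/-- Hence a point that is neither on the arc nor an endpoint has a neighbourhood missing the arc;
the approximate tangent is computed this way. -/
theorem mem_arc_of_mem_closure (h : p ≠ q) {x : E3} (hx : x ∈ closure (arc p q)) (hxp : x ≠ p)
    (hxq : x ≠ q) : x ∈ arc p q := by
  have hcl : IsClosed (line p (direction p q) '' Icc 0 ‖q - p‖) :=
    (isCompact_Icc.image (isometry_line p (norm_direction h)).continuous).isClosed
  obtain ⟨t, ht, rfl⟩ := closure_minimal (image_mono Ioo_subset_Icc_self) hcl hx
  refine ⟨t, ⟨lt_of_le_of_ne ht.1 ?_, lt_of_le_of_ne ht.2 ?_⟩, rfl⟩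
  · rintro rfl; exact hxp (line_zero _ _)
  · rintro rfl; exact hxq (line_direction_norm h)

theorem integrableOn_arc (h : p ≠ q) {f : E3 → ℝ} (hf : Continuous f) :
    IntegrableOn f (arc p q) ℋ¹ := by
  rw [IntegrableOn, arc, hausdorffMeasure_restrict_line_image _ (norm_direction h)
    measurableSet_Ioo, (measurableEmbedding_line p (norm_direction h)).integrable_map_iff]
  exact ((hf.comp (isometry_line p (norm_direction h)).continuous).integrableOn_Icc).mono_set
    Ioo_subset_Icc_self

/-- The fundamental theorem of calculus along a segment. -/
theorem setIntegral_arc_fderiv (h : p ≠ q) {ψ : E3 → ℝ} (hψ : ContDiff ℝ 1 ψ) :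
    ∫ x in arc p q, fderiv ℝ ψ x (direction p q) ∂ℋ¹ = ψ q - ψ p := by
  have hu := norm_direction h
  rw [arc, hausdorffMeasure_restrict_line_image _ hu measurableSet_Ioo,
    (measurableEmbedding_line p hu).integral_map, ← integral_Ioc_eq_integral_Ioo,
    ← intervalIntegral.integral_of_le (norm_nonneg _)]
  have hline : ∀ t, HasDerivAt (line p (direction p q)) (direction p q) t := fun t => by
    have h1 := ((hasDerivAt_id t).smul_const (direction p q)).const_add p
    rwa [one_smul] at h1
  rw [intervalIntegral.integral_eq_sub_of_hasDerivAt (f := ψ ∘ line p (direction p q))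
    (fun t _ => ((hψ.differentiable one_ne_zero _).hasFDerivAt).comp_hasDerivAt t (hline t))]
  · simp only [Function.comp, line_zero, line_direction_norm h]
  · refine Continuous.intervalIntegrable ?_ _ _
    exact ((hψ.continuous_fderiv one_ne_zero).comp (isometry_line p hu).continuous).clm_apply
      continuous_const

variable {φ : E3 → ℝ}

/-- If a `1`-Lipschitz function attains unit slope between the endpoints of a segment, then it has
unit slope at every interior point. -/
theorem exists_unit_slope (hφ : LipschitzWith 1 φ) (h : p ≠ q) (hpq : φ q - φ p = ‖q - p‖) {x : E3}
    (hx : x ∈ arc p q) : ∃ ε > 0, ∀ s : ℝ, |s| < ε →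
      line x (direction p q) s ∈ arc p q ∧ φ (line x (direction p q) s) = φ x + s := by
  have hu := norm_direction h
  have hl : ∀ s t, φ (line p (direction p q) t) - φ (line p (direction p q) s) ≤ |t - s| :=
    fun s t => by
      have := (hφ.comp (isometry_line p hu).lipschitz).dist_le_mul t s
      rw [one_mul, NNReal.coe_one, one_mul, Real.dist_eq, Real.dist_eq] at this
      exact (le_abs_self _).trans this
  -- The growth before and after `t` is bounded by the respective lengths, and the two sum to the
  -- full length, so neither bound is strict.
  have hval : ∀ t ∈ Icc 0 ‖q - p‖, φ (line p (direction p q) t) = φ p + t := by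
    intro t ht
    have h1 := hl 0 t
    have h2 := hl t ‖q - p‖
    rw [line_zero, sub_zero, abs_of_nonneg ht.1] at h1
    rw [line_direction_norm h, abs_of_nonneg (by linarith [ht.2])] at h2
    linarith
  obtain ⟨t, ht, rfl⟩ := hx
  refine ⟨min t (‖q - p‖ - t), lt_min ht.1 (by linarith [ht.2]), fun s hs => ?_⟩
  rw [lt_min_iff, abs_lt, abs_lt] at hs
  have hts : t + s ∈ Ioo 0 ‖q - p‖ := ⟨by linarith, by linarith⟩
  rw [line_line]
  refine ⟨⟨_, hts, rfl⟩, ?_⟩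
  rw [hval _ (Ioo_subset_Icc_self hts), hval _ (Ioo_subset_Icc_self ht), add_assoc]

theorem hasLineDerivAt_direction (hφ : LipschitzWith 1 φ) (h : p ≠ q)
    (hpq : φ q - φ p = ‖q - p‖) {x : E3} (hx : x ∈ arc p q) :
    HasLineDerivAt ℝ φ 1 x (direction p q) := by
  obtain ⟨ε, hε, hs⟩ := exists_unit_slope hφ h hpq hx
  have h1 : HasDerivAt (fun s : ℝ => φ x + s) 1 0 := (hasDerivAt_id 0).const_add _
  refine h1.congr_of_eventuallyEq ?_
  filter_upwards [Metric.ball_mem_nhds (0 : ℝ) hε] with s hsε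
  rw [mem_ball_zero_iff, Real.norm_eq_abs] at hsε
  exact (hs s hsε).2

/-- Two segments calibrated by the same function have the same direction where they meet. -/
theorem direction_eq_of_mem_arc (hφ : LipschitzWith 1 φ) (h : p ≠ q)
    (hpq : φ q - φ p = ‖q - p‖) {p' q' : E3} (h' : p' ≠ q') (hpq' : φ q' - φ p' = ‖q' - p'‖)
    {x : E3} (hx : x ∈ arc p q) (hx' : x ∈ arc p' q') : direction p q = direction p' q' := by
  obtain ⟨ε, hε, hs⟩ := exists_unit_slope hφ h hpq hx
  obtain ⟨ε', hε', hs'⟩ := exists_unit_slope hφ h' hpq' hx'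
  set s := min ε ε' / 2
  have hs0 : 0 < s := half_pos (lt_min hε hε')
  have hsε : s < ε := (half_lt_self (lt_min hε hε')).trans_le (min_le_left _ _)
  have hsε' : s < ε' := (half_lt_self (lt_min hε hε')).trans_le (min_le_right _ _)
  -- Step forward by `s` along one segment and backward by `s` along the other: `φ` changes by `2 *
  -- s`, so the distance `s * ‖u + v‖` is at least `2 * s`. For unit vectors this forces `u = v`.
  have h1 := (hs s (by rwa [abs_of_pos hs0])).2
  have h2 := (hs' (-s) (by rwa [abs_neg, abs_of_pos hs0])).2
  set u := direction p q
  set v := direction p' q'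
  have h3 := hφ.dist_le_mul (line x u s) (line x v (-s))
  have h4 : line x u s - line x v (-s) = s • (u + v) := by
    simp only [line, neg_smul, smul_add]; abel
  rw [h1, h2, NNReal.coe_one, one_mul, dist_eq_norm (line x u s), h4, norm_smul,
    Real.norm_of_nonneg hs0.le, Real.dist_eq] at h3
  have h5 : 2 * s ≤ s * ‖u + v‖ := by
    refine le_trans ?_ h3
    rw [show φ x + s - (φ x + -s) = 2 * s by ring]
    exact le_abs_self _
  have h6 : 2 ≤ ‖u + v‖ := by
    by_contra hlt
    nlinarith
  have h7 := parallelogram_law_with_norm ℝ u v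
  rw [norm_direction h, norm_direction h'] at h7
  have h8 : ‖u - v‖ = 0 := by nlinarith [norm_nonneg (u - v)]
  exact sub_eq_zero.1 (norm_eq_zero.1 h8)

end arc

/-! ### Currents carried by finite families of segments -/

variable {J : Type} [Fintype J] {p q : J → E3}

/-- The union of a family of segments. -/
def arcs (p q : J → E3) : Set E3 := ⋃ i, arc (p i) (q i)

open Classical in
/-- The number of segments of the family through a point. -/
noncomputable def arcMult (p q : J → E3) (x : E3) : ℕ :=
  ∑ i, if x ∈ arc (p i) (q i) then 1 else 0

/-- The sum of the directions of the segments of the family through a point. -/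
noncomputable def arcField (p q : J → E3) (x : E3) : E3 :=
  ∑ i, (arc (p i) (q i)).indicator (fun _ => direction (p i) (q i)) x

/-- The average direction of the segments of the family through a point. -/
noncomputable def arcOrient (p q : J → E3) (x : E3) : E3 := (arcMult p q x : ℝ)⁻¹ • arcField p q x

theorem arcMult_eq_sum_indicator (x : E3) :
    (arcMult p q x : ℝ) = ∑ i, (arc (p i) (q i)).indicator (fun _ => (1 : ℝ)) x := by
  classical
  simp [arcMult, indicator_apply]

theorem one_le_arcMult {x : E3} (hx : x ∈ arcs p q) : 1 ≤ arcMult p q x := by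
  classical
  obtain ⟨i, hi⟩ := mem_iUnion.1 hx
  have := Finset.single_le_sum (f := fun i => if x ∈ arc (p i) (q i) then 1 else 0)
    (fun _ _ => Nat.zero_le _) (Finset.mem_univ i)
  rwa [if_pos hi] at this

theorem arcMult_mul_apply_arcOrient {x : E3} (hx : x ∈ arcs p q) (ω : E3 →L[ℝ] ℝ) :
    (arcMult p q x : ℝ) * ω (arcOrient p q x) = ω (arcField p q x) := by
  have h0 : (arcMult p q x : ℝ) ≠ 0 := by
    have := one_le_arcMult hx
    exact_mod_cast (by omega : arcMult p q x ≠ 0)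
  rw [arcOrient, map_smul, smul_eq_mul, mul_inv_cancel_left₀ h0]

theorem measurableSet_arcs (hne : ∀ i, p i ≠ q i) : MeasurableSet (arcs p q) :=
  MeasurableSet.iUnion fun i => measurableSet_arc (hne i)

/-- Integration against a sum of indicators of the segments. -/
theorem integral_arcs_sum_indicator (hne : ∀ i, p i ≠ q i) {f : J → E3 → ℝ}
    (hf : ∀ i, IntegrableOn (f i) (arc (p i) (q i)) ℋ¹) :
    IntegrableOn (fun x => ∑ i, (arc (p i) (q i)).indicator (f i) x) (arcs p q) ℋ¹ ∧
    ∫ x in arcs p q, ∑ i, (arc (p i) (q i)).indicator (f i) x ∂ℋ¹ =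
      ∑ i, ∫ x in arc (p i) (q i), f i x ∂ℋ¹ := by
  have hint : ∀ i, Integrable ((arc (p i) (q i)).indicator (f i)) (ℋ¹.restrict (arcs p q)) :=
    fun i => ((integrable_indicator_iff (measurableSet_arc (hne i))).2 (hf i)).integrableOn
  refine ⟨integrable_finsetSum _ fun i _ => hint i, ?_⟩
  rw [integral_finsetSum _ fun i _ => hint i]
  refine Finset.sum_congr rfl fun i _ => ?_
  rw [setIntegral_indicator (measurableSet_arc (hne i)),
    arcs, inter_eq_self_of_subset_right (subset_iUnion (fun i => arc (p i) (q i)) i)]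

theorem integrableOn_arcField (hne : ∀ i, p i ≠ q i) :
    IntegrableOn (arcField p q) (arcs p q) ℋ¹ := by
  refine integrable_finsetSum _ fun i _ => Integrable.integrableOn ?_
  rw [integrable_indicator_iff (measurableSet_arc (hne i))]
  exact integrableOn_const (by rw [hausdorffMeasure_arc (hne i)]; exact ENNReal.ofReal_ne_top)

theorem integrableOn_arcMult (hne : ∀ i, p i ≠ q i) :
    IntegrableOn (fun x => (arcMult p q x : ℝ)) (arcs p q) ℋ¹ ∧
    ∫ x in arcs p q, (arcMult p q x : ℝ) ∂ℋ¹ = ∑ i, ‖q i - p i‖ := by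
  simp only [arcMult_eq_sum_indicator]
  obtain ⟨h1, h2⟩ := integral_arcs_sum_indicator hne (f := fun _ _ => (1 : ℝ)) fun i =>
    integrableOn_arc (hne i) continuous_const
  refine ⟨h1, h2.trans (Finset.sum_congr rfl fun i _ => ?_)⟩
  rw [setIntegral_const, smul_eq_mul, mul_one, measureReal_def, hausdorffMeasure_arc (hne i),
    ENNReal.toReal_ofReal (norm_nonneg _)]

/-- The current carried by a family of segments. -/
noncomputable def arcCurrent (Ω : Opens E3) (p q : J → E3) : Current Ω :=
  TestFunction.integralAgainstBilinCLM (ContinuousLinearMap.id ℝ (E3 →L[ℝ] ℝ))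
    (ℋ¹.restrict (arcs p q)) (arcField p q)

variable {Ω : Opens E3}

theorem arcCurrent_apply (hne : ∀ i, p i ≠ q i) (ω : TestForm Ω) :
    arcCurrent Ω p q ω = ∫ x in arcs p q, ω x (arcField p q x) ∂ℋ¹ :=
  TestFunction.integralAgainstBilinCLM_eq_integral
    ((integrableOn_arcField hne).locallyIntegrable.locallyIntegrableOn _)

theorem arcCurrent_apply_eq_sum (hne : ∀ i, p i ≠ q i) (ω : TestForm Ω) :
    arcCurrent Ω p q ω =
      ∑ i, ∫ x in arc (p i) (q i), ω x (direction (p i) (q i)) ∂ℋ¹ := by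
  rw [arcCurrent_apply hne, ← (integral_arcs_sum_indicator hne fun i =>
    integrableOn_arc (hne i) (ω.continuous.clm_apply continuous_const)).2]
  refine integral_congr_ae (Eventually.of_forall fun x => ?_)
  simp only [arcField, map_sum]
  refine Finset.sum_congr rfl fun i _ => ?_
  by_cases hx : x ∈ arc (p i) (q i)
  · simp only [indicator_of_mem hx]
  · simp only [indicator_of_notMem hx, map_zero]

theorem boundary_arcCurrent (hne : ∀ i, p i ≠ q i) (ψ : 𝓓(Ω, ℝ)) :
    boundary (arcCurrent Ω p q) ψ = ∑ i, (ψ (q i) - ψ (p i)) := by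
  rw [boundary, ContinuousLinearMap.comp_apply, arcCurrent_apply_eq_sum hne]
  simp only [fderivCLM_coe]
  exact Finset.sum_congr rfl fun i _ =>
    setIntegral_arc_fderiv (hne i) (ψ.contDiff.of_le (by exact_mod_cast le_top))

/-- Only an upper bound holds in general, as overlapping segments of opposite direction cancel.
Equality will come from the calibration. -/
theorem mass_arcCurrent_le (hne : ∀ i, p i ≠ q i) :
    mass (arcCurrent Ω p q) ≤ ENNReal.ofReal (∑ i, ‖q i - p i‖) := by
  refine iSup₂_le fun ω hω => ENNReal.ofReal_le_ofReal ?_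
  rw [arcCurrent_apply_eq_sum hne]
  refine Finset.sum_le_sum fun i _ => ?_
  have hμ := hausdorffMeasure_arc (hne i)
  have h := norm_setIntegral_le_of_norm_le_const (μ := ℋ¹) (C := 1)
    (f := fun x => ω x (direction (p i) (q i))) (s := arc (p i) (q i))
    (by rw [hμ]; exact ENNReal.ofReal_lt_top) fun x _ => by
      have := (ω x).le_of_opNorm_le (hω x) (direction (p i) (q i))
      rwa [norm_direction (hne i), mul_one] at this
  rw [measureReal_def, hμ, ENNReal.toReal_ofReal (norm_nonneg _), one_mul] at h
  exact (le_abs_self _).trans h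

/-- A current dominates in mass each of the values of its boundary on functions of gradient at most
one. -/
theorem iSup_boundary_le_mass (T : Current Ω) :
    ⨆ (ψ : 𝓓(Ω, ℝ)) (_ : ∀ x, ‖fderiv ℝ ψ x‖ ≤ 1), ENNReal.ofReal (boundary T ψ) ≤ mass T := by
  refine iSup₂_le fun ψ hψ => ?_
  exact le_iSup₂_of_le (f := fun (ω : TestForm Ω) (_ : ∀ x, ‖ω x‖ ≤ 1) => ENNReal.ofReal (T ω))
    (TestFunction.fderivCLM ℝ ⊤ ⊤ ψ) (fun x => by rw [fderivCLM_coe]; exact hψ x) le_rfl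

theorem countablyRectifiable_arcs (hne : ∀ i, p i ≠ q i) : CountablyRectifiable (arcs p q) := by
  -- `Option J` is nonempty even if `J` is empty; the extra index carries a constant curve.
  obtain ⟨f, hf⟩ := exists_surjective_nat (Option J)
  let γ : Option J → ℝ → E3 := fun o =>
    o.elim (fun _ => 0) fun i => line (p i) (direction (p i) (q i))
  have hγ : ∀ o, ∃ K, LipschitzWith K (γ o) := by
    rintro (_ | i)
    · exact ⟨0, LipschitzWith.const (0 : E3)⟩
    · exact ⟨1, (isometry_line _ (norm_direction (hne i))).lipschitz⟩
  refine ⟨fun n => γ (f n), fun n => hγ _, ?_⟩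
  rw [sdiff_eq_empty.2, measure_empty]
  refine iUnion_subset fun i => ?_
  obtain ⟨n, hn⟩ := hf (some i)
  refine subset_iUnion_of_subset n ?_
  simp only [hn]
  exact image_subset_range _ _

/-! ### Rectifiability and length of calibrated families -/

section calibrated

variable {φ : E3 → ℝ}

theorem arcOrient_eq_direction (hφ : LipschitzWith 1 φ) (hne : ∀ i, p i ≠ q i)
    (hpq : ∀ i, φ (q i) - φ (p i) = ‖q i - p i‖) {i : J} {x : E3} (hx : x ∈ arc (p i) (q i)) :
    arcOrient p q x = direction (p i) (q i) := by
  have h1 : arcField p q x = (arcMult p q x : ℝ) • direction (p i) (q i) := by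
    rw [arcMult_eq_sum_indicator, Finset.sum_smul, arcField]
    refine Finset.sum_congr rfl fun j _ => ?_
    by_cases hj : x ∈ arc (p j) (q j)
    · rw [indicator_of_mem hj, indicator_of_mem hj, one_smul]
      exact direction_eq_of_mem_arc hφ (hne j) (hpq j) (hne i) (hpq i) hj hx
    · rw [indicator_of_notMem hj, indicator_of_notMem hj, zero_smul]
  have h0 : (arcMult p q x : ℝ) ≠ 0 := by
    have := one_le_arcMult (mem_iUnion_of_mem i hx)
    exact_mod_cast (by omega : arcMult p q x ≠ 0)
  rw [arcOrient, h1, smul_smul, inv_mul_cancel₀ h0, one_smul]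

/-- A calibrated family of segments has an approximate tangent away from the endpoints. -/
theorem spansApproxTangent_arcs (hφ : LipschitzWith 1 φ) (hne : ∀ i, p i ≠ q i)
    (hpq : ∀ i, φ (q i) - φ (p i) = ‖q i - p i‖) {x : E3} (hx : x ∈ arcs p q)
    (hend : ∀ j, x ≠ p j ∧ x ≠ q j) : SpansApproxTangent (arcs p q) x (arcOrient p q x) := by
  obtain ⟨i, hi⟩ := mem_iUnion.1 hx
  have hdir := fun (j : J) (hj : x ∈ arc (p j) (q j)) => arcOrient_eq_direction hφ hne hpq hj
  have hu : ‖arcOrient p q x‖ = 1 := by rw [hdir i hi, norm_direction (hne i)]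
  refine ⟨hu, lt_of_lt_of_le one_pos ?_, fun s hs => ?_⟩
  -- For small `r` the segment through `x` contributes a full interval of length `2 * r`, so the
  -- density quotient is at least one.
  · refine le_limsup_of_frequently_le' (Eventually.frequently ?_)
    obtain ⟨ε, hε, hslope⟩ := exists_unit_slope hφ (hne i) (hpq i) hi
    filter_upwards [Ioo_mem_nhdsGT hε] with r hr
    have hr0 : 0 < r := hr.1
    have hsub : line x (arcOrient p q x) '' Ioo (-r) r ⊆ arcs p q ∩ Metric.closedBall x r := by
      rintro _ ⟨t, ht, rfl⟩
      have habs : |t| < r := abs_lt.2 ht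
      refine ⟨mem_iUnion_of_mem i ?_, ?_⟩
      · rw [hdir i hi]
        exact (hslope t (habs.trans hr.2)).1
      · rw [Metric.mem_closedBall, dist_eq_norm, line, add_sub_cancel_left, norm_smul, hu, mul_one]
        exact habs.le
    have h1 := measure_mono (μ := ℋ¹) hsub
    rw [hausdorffMeasure_line_image x hu measurableSet_Ioo, Real.volume_Ioo,
      show r - -r = 2 * r by ring] at h1
    rw [ENNReal.le_div_iff_mul_le (Or.inl (by simpa using hr0)) (Or.inl ENNReal.ofReal_ne_top),
      one_mul]
    exact h1
  -- Near `x` only the segments through `x` survive, and these all lie on the tangent line. The part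
  -- outside the cone is therefore empty for small `r`.
  · have hfar : ∀ j, ∀ᶠ r in 𝓝[>] (0 : ℝ), x ∈ arc (p j) (q j) ∨
        Disjoint (Metric.closedBall x r) (arc (p j) (q j)) := by
      intro j
      by_cases hj : x ∈ arc (p j) (q j)
      · exact Eventually.of_forall fun _ => Or.inl hj
      · have hcl : (closure (arc (p j) (q j)))ᶜ ∈ 𝓝 x :=
          isClosed_closure.isOpen_compl.mem_nhds fun hx' =>
            hj (mem_arc_of_mem_closure (hne j) hx' (hend j).1 (hend j).2)
        obtain ⟨R, hR, hsub⟩ := Metric.nhds_basis_closedBall.mem_iff.1 hcl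
        filter_upwards [Ioo_mem_nhdsGT hR] with r hr
        refine Or.inr (Set.disjoint_left.2 fun y hy hy' => ?_)
        exact hsub (Metric.closedBall_subset_closedBall hr.2.le hy) (subset_closure hy')
    refine tendsto_const_nhds.congr' ?_
    filter_upwards [eventually_all.2 hfar] with r hr
    have hempty : {y ∈ arcs p q ∩ Metric.closedBall x r | s * ‖y - x‖ <
        Metric.infDist (y - x) (Submodule.span ℝ {arcOrient p q x} : Set E3)} = ∅ := by
      refine eq_empty_of_forall_notMem ?_
      rintro y ⟨⟨hy, hyr⟩, hlt⟩
      obtain ⟨j, hj⟩ := mem_iUnion.1 hy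
      rcases hr j with hxj | hdisj
      · have hmem : y - x ∈ (Submodule.span ℝ {arcOrient p q x} : Set E3) := by
          rw [hdir j hxj]
          obtain ⟨a, -, rfl⟩ := hj
          obtain ⟨b, -, rfl⟩ := hxj
          rw [line_sub_line]
          exact Submodule.smul_mem _ _ (Submodule.mem_span_singleton_self _)
        rw [Metric.infDist_zero_of_mem hmem] at hlt
        exact absurd hlt (not_lt.2 (mul_nonneg hs.1.le (norm_nonneg _)))
      · exact Set.disjoint_left.1 hdisj hyr hj
    rw [hempty, measure_empty, ENNReal.zero_div]

/-- A calibrated family of segments carries an integer multiplicity rectifiable current. -/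
theorem isRectifiableCurrent_arcCurrent (hφ : LipschitzWith 1 φ) (hne : ∀ i, p i ≠ q i)
    (hpq : ∀ i, φ (q i) - φ (p i) = ‖q i - p i‖) (hsub : ∀ i, arc (p i) (q i) ⊆ Ω) :
    IsRectifiableCurrent (arcCurrent Ω p q) (arcs p q) (arcMult p q) (arcOrient p q) where
  subset := iUnion_subset hsub
  measurable := (measurableSet_arcs hne).nullMeasurableSet
  rectifiable := countablyRectifiable_arcs hne
  mult_pos _ hx := one_le_arcMult hx
  mult_locInt := (integrableOn_arcMult hne).1.locallyIntegrable.locallyIntegrableOn _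
  orient_meas := ((integrableOn_arcMult hne).1.aestronglyMeasurable.aemeasurable.inv.smul
    (integrableOn_arcField hne).aestronglyMeasurable.aemeasurable).aestronglyMeasurable
  orient := by
    -- The excluded endpoints form a finite set, which is `ℋ¹`-null.
    have hfin : (range p ∪ range q).Finite := (finite_range p).union (finite_range q)
    have := Measure.nullSingletonClass_hausdorff E3 one_pos
    rw [ae_restrict_iff' (measurableSet_arcs hne)]
    filter_upwards [compl_mem_ae_iff.2 (hfin.measure_zero ℋ¹)] with x hx hxM
    refine spansApproxTangent_arcs hφ hne hpq hxM fun j => ⟨?_, ?_⟩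
    · rintro rfl; exact hx (Or.inl ⟨j, rfl⟩)
    · rintro rfl; exact hx (Or.inr ⟨j, rfl⟩)
  eq_integral ω := by
    rw [arcCurrent_apply hne]
    exact setIntegral_congr_fun (measurableSet_arcs hne) fun x hx =>
      (arcMult_mul_apply_arcOrient hx _).symm

theorem hasLineDerivAt_arcOrient (hφ : LipschitzWith 1 φ) (hne : ∀ i, p i ≠ q i)
    (hpq : ∀ i, φ (q i) - φ (p i) = ‖q i - p i‖) {x : E3} (hx : x ∈ arcs p q) :
    HasLineDerivAt ℝ φ 1 x (arcOrient p q x) := by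
  obtain ⟨i, hi⟩ := mem_iUnion.1 hx
  rw [arcOrient_eq_direction hφ hne hpq hi]
  exact hasLineDerivAt_direction hφ (hne i) (hpq i) hi

/-- The length of a calibrated family of segments is a supremum over test functions. -/
theorem length_le_iSup_boundary (hφ : LipschitzWith 1 φ) (hout : ∀ z, 1 ≤ ‖z‖ → φ z = 0)
    (hne : ∀ i, p i ≠ q i) (hpq : ∀ i, φ (q i) - φ (p i) = ‖q i - p i‖) :
    ENNReal.ofReal (∑ i, ‖q i - p i‖) ≤ ⨆ (ψ : 𝓓(unitBall, ℝ)) (_ : ∀ x, ‖fderiv ℝ ψ x‖ ≤ 1),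
      ENNReal.ofReal (boundary (arcCurrent unitBall p q) ψ) := by
  refine ENNReal.le_of_forall_pos_le_add fun ε hε _ => ?_
  obtain ⟨n, hn⟩ : ∃ n : ℝ, n = Fintype.card J := ⟨_, rfl⟩
  have hn0 : 0 ≤ n := hn ▸ Nat.cast_nonneg _
  have hε' : (0 : ℝ) < ε := hε
  -- Each of the `n` segments loses the approximation error at both ends, `2 * n` times in all; the
  -- `+ 1` covers `n = 0`.
  obtain ⟨ψ, hψ1, hψ⟩ := exists_testFunction_approx hφ hout
    (ε := ε / (2 * n + 1)) (by positivity)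
  have hsum : ∑ i, ‖q i - p i‖ ≤ boundary (arcCurrent unitBall p q) ψ + ε := by
    rw [boundary_arcCurrent hne]
    have h1 : ∀ i, ‖q i - p i‖ ≤ (ψ (q i) - ψ (p i)) + 2 * (ε / (2 * n + 1)) := fun i => by
      have h2 := (abs_le.1 (hψ (q i))).1
      have h3 := (abs_le.1 (hψ (p i))).2
      rw [← hpq i]
      linarith
    refine (Finset.sum_le_sum fun i _ => h1 i).trans ?_
    rw [Finset.sum_add_distrib, Finset.sum_const, Finset.card_univ, nsmul_eq_mul, ← hn]
    have h4 : n * (2 * (ε / (2 * n + 1))) ≤ ε := by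
      rw [← mul_assoc, ← mul_div_assoc, div_le_iff₀ (by positivity)]
      nlinarith
    linarith
  refine (ENNReal.ofReal_le_ofReal hsum).trans (ENNReal.ofReal_add_le.trans ?_)
  rw [ENNReal.ofReal_coe_nnreal]
  gcongr
  exact le_iSup₂_of_le (f := fun (ψ : 𝓓(unitBall, ℝ)) (_ : ∀ x, ‖fderiv ℝ ψ x‖ ≤ 1) =>
    ENNReal.ofReal (boundary (arcCurrent unitBall p q) ψ)) ψ hψ1 le_rfl

end calibrated

end BallCurrents

/-! ### The decomposition of `T_X` -/

open BallCurrents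

theorem theorem7p1 (X : E3 → E3) (hX : SmoothAwayFromIntegerSingularities unitBall X) :
    ∃ L C : Current unitBall,
      IntegerRectifiable L ∧ mass L < ⊤ ∧ boundary C = 0 ∧
      currentOfField unitBall X = C + L ∧
      (boundary L = boundary (currentOfField unitBall X) ∧
        ∀ T : Current unitBall, IntegerRectifiable T →
          boundary T = boundary (currentOfField unitBall X) → mass L ≤ mass T) ∧
      mass L = ⨆ (φ : 𝓓(unitBall, ℝ)) (_ : ∀ x, ‖fderiv ℝ φ x‖ ≤ 1),
        ENNReal.ofReal (boundary (currentOfField unitBall X) φ) ∧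
      ∃ φ : E3 → ℝ, LipschitzOnWith 1 φ (unitBall : Set E3) ∧
        (∀ y ∈ frontier (unitBall : Set E3), Tendsto φ (𝓝[(unitBall : Set E3)] y) (𝓝 0)) ∧
        IsCalibratedBy L φ := by
  obtain ⟨hint, S, h, hS, -, hdiv⟩ := hX
  -- The charge is `-h` because `⟨∂T_X, ψ⟩ = ∫ dψ(X)`, which is minus the distributional divergence
  -- of `X` tested on `ψ`.
  obtain ⟨J, _, p, q, φ, hφ, hout, hseg, hsum⟩ := exists_calibrated_connection S
    (fun a ha => (mem_ball_zero_iff.1 (hS ha)).le) fun a => -h a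
  have hne : ∀ i, p i ≠ q i := fun i => (hseg i).1
  have hpq : ∀ i, φ (q i) - φ (p i) = ‖q i - p i‖ := fun i => (hseg i).2.2.2
  have hbdry : boundary (arcCurrent unitBall p q) = boundary (currentOfField unitBall X) := by
    ext ψ
    have hψ0 : ∀ z, 1 ≤ ‖z‖ → ψ z = 0 := fun z hz => image_eq_zero_of_notMem_tsupport fun hz' =>
      (mem_ball_zero_iff.1 (ψ.tsupport_subset hz')).not_ge hz
    rw [boundary_arcCurrent hne, hsum ψ hψ0, boundary, ContinuousLinearMap.comp_apply,
      currentOfField_apply hint]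
    simp only [fderivCLM_coe]
    rw [← neg_inj, hdiv ψ, ← Finset.sum_neg_distrib]
    simp
  have hmass : mass (arcCurrent unitBall p q) = ENNReal.ofReal (∑ i, ‖q i - p i‖) :=
    (mass_arcCurrent_le hne).antisymm
      ((length_le_iSup_boundary hφ hout hne hpq).trans (iSup_boundary_le_mass _))
  have hsup : mass (arcCurrent unitBall p q) =
      ⨆ (ψ : 𝓓(unitBall, ℝ)) (_ : ∀ x, ‖fderiv ℝ ψ x‖ ≤ 1),
        ENNReal.ofReal (boundary (currentOfField unitBall X) ψ) := by
    rw [← hbdry]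
    exact ((mass_arcCurrent_le hne).trans (length_le_iSup_boundary hφ hout hne hpq)).antisymm
      (iSup_boundary_le_mass _)
  have hrect := isRectifiableCurrent_arcCurrent (Ω := unitBall) hφ hne hpq fun i =>
    arc_subset_ball (hne i) (hseg i).2.1 (hseg i).2.2.1
  have hline : ∀ x ∈ arcs p q, HasLineDerivAt ℝ φ 1 x (arcOrient p q x) := fun x hx =>
    hasLineDerivAt_arcOrient hφ hne hpq hx
  -- As `φ` has slope one along the orientation, the calibration integral is the integral of the
  -- multiplicity, that is, the total length.
  have hcongr : EqOn (fun x => (arcMult p q x : ℝ))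
      (fun x => (arcMult p q x : ℝ) * lineDeriv ℝ φ x (arcOrient p q x)) (arcs p q) :=
    fun x hx => by simp only [(hline x hx).lineDeriv, mul_one]
  obtain ⟨hmint, hmval⟩ := integrableOn_arcMult hne
  refine ⟨arcCurrent unitBall p q, currentOfField unitBall X - arcCurrent unitBall p q,
    ⟨_, _, _, hrect⟩, ?_, ?_, ?_, ⟨hbdry, fun T _ hT => ?_⟩, hsup, φ, hφ.lipschitzOnWith,
    ?_, ?_, _, _, _, hrect, ?_, ?_, ?_⟩
  · rw [hmass]; exact ENNReal.ofReal_lt_top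
  · rw [boundary, ContinuousLinearMap.sub_comp, sub_eq_zero]
    exact hbdry.symm
  · rw [sub_add_cancel]
  · rw [hsup, ← hT]
    exact iSup_boundary_le_mass T
  · intro y hy
    have hy1 : ‖y‖ = 1 := by
      have hy' : y ∈ frontier (Metric.ball (0 : E3) 1) := hy
      rwa [frontier_ball _ one_ne_zero, mem_sphere_zero_iff_norm] at hy'
    have h1 := hφ.continuous.tendsto y
    rw [hout y hy1.ge] at h1
    exact h1.mono_left nhdsWithin_le_nhds
  · refine ae_restrict_of_ae ?_
    filter_upwards [hφ.ae_differentiableAt] with x hx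
    refine ⟨hx, ?_⟩
    have h1 := norm_fderiv_le_of_lipschitz ℝ hφ (x₀ := x)
    rwa [NNReal.coe_one] at h1
  · rw [ae_restrict_iff' (measurableSet_arcs hne)]
    exact Eventually.of_forall fun x hx => (hline x hx).lineDifferentiableAt
  · exact hmint.congr_fun hcongr (measurableSet_arcs hne)
  · rw [hmass, ← hmval]
    exact congrArg _ (setIntegral_congr_fun (measurableSet_arcs hne) hcongr)
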